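/- Let $\Omega$ be a non-empty set, let $\mathfrak F(\Omega)$ be the set of all functions $\Omega\to\mathbb R$, and let $\ge_*$ be a reflexive and transitive relation on $\mathfrak F(\Omega)$ with asymmetric part $>_*$ such that (i) $1>_*0$; (ii) $f\ge g$ pointwise implies $f\ge_*g$; (iii) $f\ge_*g$ implies $bf+h\ge_*bg+h$ for every bounded $b\ge0$ and every $h\in\mathfrak F(\Omega)$; (iv) $f>_*0$ implies $f\wedge1>_*0$. Let $\mathcal X\subset\mathfrak F(\Omega)$ be a convex set that contains the constants $0$ and $1$, such that every $f\in\mathcal X$ satisfies $f\ge_*a$ for some $a\in\mathbb R$, and such that $f+\lambda\in\mathcal X$ whenever $f\in\mathcal X$ and $\lambda\ge0$. Let $\pi:\mathcal X\to\mathbb R$ be positively homogeneous and subadditive (whenever the payoffs involved lie in $\mathcal X$), with $\pi(1)=1$, with $\pi(X)\ge\pi(Y)$ whenever $X,Y\in\mathcal X$ and $X\ge_*Y$, and with $\pi(X)>0$ whenever $X\in\mathcal X$ and $X>_*0$. Put $$L(\mathcal X)=\{g\in\mathfrak F(\Omega):\lambda X\ge_*|g|\text{ for some }\lambda>0,\ X\in\mathcal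 X\},$$ $$\mathcal C(\pi)=\{g\in\mathfrak F(\Omega):\lambda[X-\pi(X)]\ge_*g\text{ for some }\lambda>0,\ X\in\mathcal X\}.$$ Let $\mathbb P(\Omega)$ be the set of finitely additive probabilities on the power set of $\Omega$. For $m\in\mathbb P(\Omega)$, a function $f$ belongs to $L^1(m)$ if there is a sequence of finitely valued functions $s_n$ that converges to $f$ in $m$-measure and satisfies $\int|s_n-s_k|\,dm\to0$ as $n,k\to\infty$; then $\int f\,dm=\lim_n\int s_n\,dm$. For $A\subset\mathfrak F(\Omega)$, let $\overline{A}^{L^1(m)}$ be the closure of $A\cap L^1(m)$ in $L^1(m)$ for the distance $\int|f-g|\,dm$. Let $\mathcal M(\pi)$ be the set of all $m\in\mathbb P(\Omega)$ such that $L(\mathcal X)\subset L^1(m)$, $\int X\,dm\le\pi(X)$ for every $X\in\mathcal X$, and $\int(f\wedge1)\,dm>0$ for every $f\in\mathfrak F(\Omega)$ with $f>_*0$. Then $\mathcal M(\pi)\ne\emptyset$ if and only if there exists $\mu\in\mathbb P(\Omega)$ such that $$\mathcal X\subset L^1(\mu)\quad\text{and}\quad\overline{\mathcal C(\pi)}^{L^1(\mu)}\cap\{f\in\mathfrak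 F(\Omega):f>_*0\}=\emptyset.$$ In this case one may choose $\mu\in\mathcal M(\pi)$. -/

import Mathlib

open Filter Topology

noncomputable section

/-! ### Finitely additive probabilities on the power set and their integral -/

/-- A finitely additive probability defined on all subsets of `Ω`. -/
structure FinAddProb (Ω : Type*) where
  /-- the mass of a set -/
  mass : Set Ω → ℝ
  mass_nonneg : ∀ A : Set Ω, 0 ≤ mass A
  mass_univ : mass Set.univ = 1
  mass_union : ∀ A B : Set Ω, Disjoint A B → mass (A ∪ B) = mass A + mass B

namespace FinAddProb

variable {Ω : Type*}

/-- The integral `∑ y, y * μ(s = y)` of a simple (i.e. finitely valued) function `s`. Every subset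
of `Ω` is measurable, so every finitely valued function is simple; for such an `s` only finitely
many terms are nonzero. -/
def simpleIntegral (μ : FinAddProb Ω) (s : Ω → ℝ) : ℝ :=
  ∑ᶠ y : ℝ, y * μ.mass (s ⁻¹' {y})

/-- `s` is a determining sequence for `f`: a sequence of simple functions that converges to `f` in
`μ`-measure and is Cauchy for the `L¹` distance of simple functions. -/
structure IsDetermining (μ : FinAddProb Ω) (s : ℕ → Ω → ℝ) (f : Ω → ℝ) : Prop where
  simple : ∀ n, (Set.range (s n)).Finite
  tendsto_in_measure : ∀ ε : ℝ, 0 < ε →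
    Tendsto (fun n => μ.mass {ω | ε ≤ |f ω - s n ω|}) atTop (𝓝 0)
  cauchy : Tendsto (fun p : ℕ × ℕ => μ.simpleIntegral (fun ω => |s p.1 ω - s p.2 ω|))
    atTop (𝓝 0)

/-- `I` is the integral of `f`, in the sense of the Dunford-Schwartz integral for finitely additive
set functions: the limit of the integrals along a determining sequence. -/
def HasIntegral (μ : FinAddProb Ω) (f : Ω → ℝ) (I : ℝ) : Prop :=
  ∃ s : ℕ → Ω → ℝ, μ.IsDetermining s f ∧
    Tendsto (fun n => μ.simpleIntegral (s n)) atTop (𝓝 I)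

/-- The space `L¹(μ)` of integrable functions. -/
def L1 (μ : FinAddProb Ω) : Set (Ω → ℝ) :=
  {f | ∃ s : ℕ → Ω → ℝ, μ.IsDetermining s f}

open Classical in
/-- The integral `∫ f dμ` (with value `0` when there is none). -/
def integral (μ : FinAddProb Ω) (f : Ω → ℝ) : ℝ :=
  if h : ∃ I : ℝ, μ.HasIntegral f I then h.choose else 0

/-- The closure in `L¹(μ)` of (the part in `L¹(μ)` of) a set `A` of functions, for the distance
`∫ |f - g| dμ`. -/
def closureL1 (μ : FinAddProb Ω) (A : Set (Ω → ℝ)) : Set (Ω → ℝ) :=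
  {f | f ∈ μ.L1 ∧ ∀ ε : ℝ, 0 < ε →
    ∃ g ∈ A, g ∈ μ.L1 ∧ μ.integral (fun ω => |f ω - g ω|) < ε}

end FinAddProb

/-! ### Economic rationality, assets and prices -/

/-- The criterion of collective rationality `≥_*`: a reflexive and transitive relation on the real
functions on `Ω`; `ge f g` stands for `f ≥_* g`. -/
structure CommonOrder (Ω : Type*) where
  /-- the relation `f ≥_* g` -/
  ge : (Ω → ℝ) → (Ω → ℝ) → Prop
  refl : ∀ f, ge f f
  trans : ∀ f g h, ge f g → ge g h → ge f h
  one_gt_zero : ge 1 0 ∧ ¬ ge 0 1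
  mono : ∀ f g : Ω → ℝ, g ≤ f → ge f g
  affine : ∀ f g b h : Ω → ℝ, ge f g → 0 ≤ b → (∃ K : ℝ, ∀ ω, b ω ≤ K) →
    ge (b * f + h) (b * g + h)
  trunc : ∀ f : Ω → ℝ, ge f 0 ∧ ¬ ge 0 f → ge (f ⊓ 1) 0 ∧ ¬ ge 0 (f ⊓ 1)

namespace CommonOrder

variable {Ω : Type*}

/-- The asymmetric part `f >_* g` of `≥_*`. -/
def gt (R : CommonOrder Ω) (f g : Ω → ℝ) : Prop :=
  R.ge f g ∧ ¬ R.ge g f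

/-- The assumptions on the set `𝒳` of the payoffs of the traded assets. -/
structure IsAssetSet (R : CommonOrder Ω) (𝒳 : Set (Ω → ℝ)) : Prop where
  convex : Convex ℝ 𝒳
  zero_mem : (0 : Ω → ℝ) ∈ 𝒳
  one_mem : (1 : Ω → ℝ) ∈ 𝒳
  bounded_loss : ∀ f ∈ 𝒳, ∃ a : ℝ, R.ge f (fun _ => a)
  add_cash : ∀ f ∈ 𝒳, ∀ c : ℝ, 0 ≤ c → (fun ω => f ω + c) ∈ 𝒳

/-- Price functions `π ∈ Π(𝒳)`: positively homogeneous, subadditive, normalized, `≥_*`-monotone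
and free of arbitrage. -/
structure IsPriceFunction (R : CommonOrder Ω) (𝒳 : Set (Ω → ℝ)) (π : 𝒳 → ℝ) : Prop where
  pos_homogeneous : ∀ (c : ℝ) (X Y : 𝒳), 0 ≤ c → (Y : Ω → ℝ) = c • (X : Ω → ℝ) → π Y = c * π X
  subadditive : ∀ X Y Z : 𝒳, (Z : Ω → ℝ) = (X : Ω → ℝ) + (Y : Ω → ℝ) → π Z ≤ π X + π Y
  normalized : ∀ X : 𝒳, (X : Ω → ℝ) = 1 → π X = 1
  monotone : ∀ X Y : 𝒳, R.ge (X : Ω → ℝ) (Y : Ω → ℝ) → π Y ≤ π X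
  no_arbitrage : ∀ X : 𝒳, R.gt (X : Ω → ℝ) 0 → 0 < π X

/-- The set `L(𝒳)` of the payoffs `g` with `λ X ≥_* |g|` for some `λ > 0` and `X ∈ 𝒳`. -/
def superhedgeable (R : CommonOrder Ω) (𝒳 : Set (Ω → ℝ)) : Set (Ω → ℝ) :=
  {g | ∃ c : ℝ, 0 < c ∧ ∃ X ∈ 𝒳, R.ge (c • X) (fun ω => |g ω|)}

/-- The set `𝒞(π)` of the `g` with `λ (X - π(X)) ≥_* g` for some `λ > 0` and `X ∈ 𝒳`. -/
def netCone (R : CommonOrder Ω) {𝒳 : Set (Ω → ℝ)} (π : 𝒳 → ℝ) : Set (Ω → ℝ) :=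
  {g | ∃ c : ℝ, 0 < c ∧ ∃ X : 𝒳, R.ge (fun ω => c * ((X : Ω → ℝ) ω - π X)) g}

/-- The set `ℳ₀(π)` of pricing measures. -/
def pricingMeasures (R : CommonOrder Ω) {𝒳 : Set (Ω → ℝ)} (π : 𝒳 → ℝ) : Set (FinAddProb Ω) :=
  {m | R.superhedgeable 𝒳 ⊆ m.L1 ∧ ∀ X : 𝒳, m.integral (X : Ω → ℝ) ≤ π X}

/-- The set `ℳ(π)` of strictly positive pricing measures: `∫ (f ∧ 1) dm > 0` if `f >_* 0`. -/
def strictPricingMeasures (R : CommonOrder Ω) {𝒳 : Set (Ω → ℝ)} (π : 𝒳 → ℝ) :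
    Set (FinAddProb Ω) :=
  {m | m ∈ R.pricingMeasures π ∧ ∀ f : Ω → ℝ, R.gt f 0 → 0 < m.integral (f ⊓ 1)}

end CommonOrder

end

noncomputable section

namespace FinAddProb

variable {Ω : Type*} (μ : FinAddProb Ω)

/-! ### Finitely additive probabilities -/

/-! A measure `m` in `ℳ(π)` serves as its own `μ`. Strict positivity makes every `A` with `0 ≥_*
1_A` an `m`-null set, so `f ≥_* g` forces `f ≥ g` up to `m`-null functions and the integral is
monotone for `≥_*`. Hence integrable elements of `𝒞(π)` have integral at most `0`, and so do their
`L¹` limits, whereas an integrable `f >_* 0` has `∫ f ≥ ∫ (f ∧ 1) > 0`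
(`closureL1_netCone_inter_eq_empty`).

Conversely, given `μ`, the set `𝒞(π)` is a convex cone containing all nonpositive functions
(`isSolidCone_netCone`). By Hahn–Banach, each `f >_* 0` in `L¹(μ)` is charged by a functional
dominated by the `L¹` seminorm and nonpositive on the cone (`exists_separatingFunctional_pos`). A
Halmos–Savage exhaustion replaces these by a single `φ` whose null sets are null for all of them
(`exists_maximal_separatingFunctional`). Continuity from below is not available, so the exhaustion
maximizes the infimum over `B` of `n φ(B) + μ(Bᶜ)` rather than the mass of a support.

Normalized, `φ` is integration against a probability `m` with `m ≤ K μ` (`functional_eq_integral`).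
Then `X - π(X) ∈ 𝒞(π)` gives the price bound. If `f >_* 0` but the positive part of `f ∧ 1` had
`m`-integral zero, its level sets `{· ≥ ε}` would be null for every separating functional, so none
could charge it, contrary to separation. -/

theorem mass_empty : μ.mass ∅ = 0 := by
  have := μ.mass_union ∅ ∅ (by simp)
  simp only [Set.union_self] at this
  linarith

theorem mass_mono {A B : Set Ω} (h : A ⊆ B) : μ.mass A ≤ μ.mass B := by
  have := μ.mass_union A (B \ A) Set.disjoint_sdiff_right
  rw [Set.union_sdiff_cancel h] at this
  linarith [μ.mass_nonneg (B \ A)]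

theorem mass_union_le (A B : Set Ω) : μ.mass (A ∪ B) ≤ μ.mass A + μ.mass B := by
  have := μ.mass_union A (B \ A) Set.disjoint_sdiff_right
  rw [Set.union_sdiff_self] at this
  linarith [μ.mass_mono (Set.sdiff_subset : B \ A ⊆ B)]

theorem mass_eq_zero_of_subset {A B : Set Ω} (h : A ⊆ B) (hB : μ.mass B = 0) : μ.mass A = 0 := by
  linarith [μ.mass_mono h, μ.mass_nonneg A]

/-! ### Integrals of simple functions -/

theorem finite_range_comp₂ {s t : Ω → ℝ} (hs : (Set.range s).Finite) (ht : (Set.range t).Finite)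
    (F : ℝ → ℝ → ℝ) : (Set.range fun ω => F (s ω) (t ω)).Finite := by
  refine (Set.Finite.image2 F hs ht).subset ?_
  rintro _ ⟨ω, rfl⟩
  exact ⟨s ω, ⟨ω, rfl⟩, t ω, ⟨ω, rfl⟩, rfl⟩

theorem finite_range_comp {s : Ω → ℝ} (hs : (Set.range s).Finite) (F : ℝ → ℝ) :
    (Set.range fun ω => F (s ω)).Finite :=
  finite_range_comp₂ hs hs fun x _ => F x

theorem finite_range_const (c : ℝ) : (Set.range fun _ : Ω => c).Finite :=
  (Set.finite_singleton c).subset Set.range_const_subset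

theorem finite_range_indicator (A : Set Ω) (c : ℝ) :
    (Set.range (A.indicator fun _ => c)).Finite := by
  refine (Set.toFinite {0, c}).subset ?_
  rintro _ ⟨ω, rfl⟩
  by_cases h : ω ∈ A <;> simp [h]

theorem exists_bound_of_finite_range {s : Ω → ℝ} (hs : (Set.range s).Finite) :
    ∃ M : ℝ, 0 ≤ M ∧ ∀ ω, |s ω| ≤ M := by
  obtain ⟨M, hM⟩ := (finite_range_comp hs fun x => |x|).bddAbove
  exact ⟨max M 0, le_max_right _ _, fun ω => (hM ⟨ω, rfl⟩).trans (le_max_left _ _)⟩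

/-- A finitely valued function as a simple function for the power set. -/
def toSimpleFunc (s : Ω → ℝ) (hs : (Set.range s).Finite) : @MeasureTheory.SimpleFunc Ω ⊤ ℝ :=
  @MeasureTheory.SimpleFunc.mk Ω ⊤ ℝ s (fun _ => trivial) hs

/-- The mass of a set as a continuous linear map of scalars. -/
def massCLM (A : Set Ω) : ℝ →L[ℝ] ℝ := μ.mass A • ContinuousLinearMap.id ℝ ℝ

/-- The zero reference measure makes the finiteness side conditions trivial, so linearity of the
simple integral can be taken from `setToSimpleFunc`, which needs finite additivity only. -/
theorem massCLM_additive :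
    @MeasureTheory.FinMeasAdditive Ω _ _ ⊤ (0 : @MeasureTheory.Measure Ω ⊤) μ.massCLM := by
  intro A B _ _ _ _ h
  simp [massCLM, μ.mass_union A B h, add_smul]

theorem simpleIntegral_eq_sum {s : Ω → ℝ} {S : Finset ℝ} (hS : Set.range s ⊆ S) :
    μ.simpleIntegral s = ∑ y ∈ S, y * μ.mass (s ⁻¹' {y}) := by
  refine finsum_eq_sum_of_support_subset _ fun y hy => hS ?_
  by_contra h
  have : s ⁻¹' {y} = ∅ := Set.preimage_singleton_eq_empty.2 h
  simp [this, mass_empty] at hy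

theorem simpleIntegral_eq_setToSimpleFunc {s : Ω → ℝ} (hs : (Set.range s).Finite) :
    μ.simpleIntegral s = @MeasureTheory.SimpleFunc.setToSimpleFunc Ω ℝ ℝ _ _ _ _ ⊤ μ.massCLM
      (toSimpleFunc s hs) := by
  let _ : MeasurableSpace Ω := ⊤
  rw [μ.simpleIntegral_eq_sum (S := (toSimpleFunc s hs).range)
    (by rw [MeasureTheory.SimpleFunc.coe_range]; rfl)]
  refine Finset.sum_congr rfl fun y _ => ?_
  exact mul_comm _ _

theorem simpleIntegral_add {s t : Ω → ℝ} (hs : (Set.range s).Finite) (ht : (Set.range t).Finite) :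
    μ.simpleIntegral (fun ω => s ω + t ω) = μ.simpleIntegral s + μ.simpleIntegral t := by
  let _ : MeasurableSpace Ω := ⊤
  rw [μ.simpleIntegral_eq_setToSimpleFunc hs, μ.simpleIntegral_eq_setToSimpleFunc ht,
    μ.simpleIntegral_eq_setToSimpleFunc (finite_range_comp₂ hs ht fun x y => x + y),
    ← MeasureTheory.SimpleFunc.setToSimpleFunc_add _ μ.massCLM_additive (by simp) (by simp)]
  rfl

theorem simpleIntegral_smul {s : Ω → ℝ} (hs : (Set.range s).Finite) (c : ℝ) :
    μ.simpleIntegral (fun ω => c * s ω) = c * μ.simpleIntegral s := by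
  let _ : MeasurableSpace Ω := ⊤
  rw [μ.simpleIntegral_eq_setToSimpleFunc hs,
    μ.simpleIntegral_eq_setToSimpleFunc (finite_range_comp hs fun x => c * x), ← smul_eq_mul c,
    ← MeasureTheory.SimpleFunc.setToSimpleFunc_smul_real _ μ.massCLM_additive c (by simp)]
  rfl

theorem simpleIntegral_sub {s t : Ω → ℝ} (hs : (Set.range s).Finite) (ht : (Set.range t).Finite) :
    μ.simpleIntegral (fun ω => s ω - t ω) = μ.simpleIntegral s - μ.simpleIntegral t := by
  have := μ.simpleIntegral_add hs (finite_range_comp ht fun x => -1 * x)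
  rw [μ.simpleIntegral_smul ht] at this
  convert this using 1
  · congr 1; ext ω; ring
  · ring

theorem simpleIntegral_nonneg {s : Ω → ℝ} (h : ∀ ω, 0 ≤ s ω) : 0 ≤ μ.simpleIntegral s := by
  refine finsum_nonneg fun y => ?_
  rcases (s ⁻¹' {y}).eq_empty_or_nonempty with he | ⟨ω, hω⟩
  · simp [he, mass_empty]
  · exact mul_nonneg (hω ▸ h ω) (μ.mass_nonneg _)

theorem simpleIntegral_mono {s t : Ω → ℝ} (hs : (Set.range s).Finite) (ht : (Set.range t).Finite)
    (h : ∀ ω, s ω ≤ t ω) : μ.simpleIntegral s ≤ μ.simpleIntegral t := by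
  have := μ.simpleIntegral_nonneg (s := fun ω => t ω - s ω) fun ω => sub_nonneg.2 (h ω)
  rw [μ.simpleIntegral_sub ht hs] at this
  linarith

theorem simpleIntegral_const (c : ℝ) : μ.simpleIntegral (fun _ => c) = c := by
  rw [μ.simpleIntegral_eq_sum (S := {c}) (by simp)]
  simp [μ.mass_univ]

theorem simpleIntegral_indicator (A : Set Ω) :
    μ.simpleIntegral (A.indicator fun _ => 1) = μ.mass A := by
  have h : Set.range (A.indicator fun _ => (1 : ℝ)) ⊆ ({0, 1} : Finset ℝ) := by
    rintro _ ⟨ω, rfl⟩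
    by_cases h : ω ∈ A <;> simp [h]
  have h1 : (A.indicator fun _ => (1 : ℝ)) ⁻¹' {1} = A := by
    ext ω
    by_cases h : ω ∈ A <;> simp [h]
  rw [μ.simpleIntegral_eq_sum h, Finset.sum_pair zero_ne_one, h1]
  simp

theorem abs_simpleIntegral_sub_le {s t : Ω → ℝ} (hs : (Set.range s).Finite)
    (ht : (Set.range t).Finite) :
    |μ.simpleIntegral s - μ.simpleIntegral t| ≤ μ.simpleIntegral fun ω => |s ω - t ω| := by
  have hd := finite_range_comp₂ hs ht fun x y => |x - y|
  have h1 := μ.simpleIntegral_mono (finite_range_comp₂ hs ht fun x y => x - y) hd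
    fun ω => le_abs_self _
  have h2 := μ.simpleIntegral_mono (finite_range_comp₂ ht hs fun x y => x - y) hd
    fun ω => by rw [abs_sub_comm]; exact le_abs_self _
  rw [μ.simpleIntegral_sub hs ht] at h1
  rw [μ.simpleIntegral_sub ht hs] at h2
  exact abs_le.2 ⟨by linarith, h1⟩

theorem simpleIntegral_le_mul {ν : FinAddProb Ω} {K : ℝ} (h : ∀ A, ν.mass A ≤ K * μ.mass A)
    {s : Ω → ℝ} (hs : (Set.range s).Finite) (h0 : ∀ ω, 0 ≤ s ω) :
    ν.simpleIntegral s ≤ K * μ.simpleIntegral s := by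
  have hS : Set.range s ⊆ hs.toFinset := by simp
  rw [μ.simpleIntegral_eq_sum hS, ν.simpleIntegral_eq_sum hS, Finset.mul_sum]
  refine Finset.sum_le_sum fun y hy => ?_
  obtain ⟨ω, rfl⟩ := hs.mem_toFinset.1 hy
  nlinarith [h (s ⁻¹' {s ω}), h0 ω]

/-! ### Determining sequences -/

variable {μ}

theorem simpleIntegral_abs_tendsto_zero {u : ℕ → Ω → ℝ} (hu : ∀ n, (Set.range (u n)).Finite)
    (hm : ∀ ε : ℝ, 0 < ε → Tendsto (fun n => μ.mass {ω | ε ≤ |u n ω|}) atTop (𝓝 0))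
    (hc : Tendsto (fun p : ℕ × ℕ => μ.simpleIntegral (fun ω => |u p.1 ω - u p.2 ω|))
      atTop (𝓝 0)) :
    Tendsto (fun n => μ.simpleIntegral fun ω => |u n ω|) atTop (𝓝 0) := by
  have hpos : ∀ n, 0 ≤ μ.simpleIntegral fun ω => |u n ω| :=
    fun n => μ.simpleIntegral_nonneg fun ω => abs_nonneg _
  rw [Metric.tendsto_atTop]
  intro ε hε
  obtain ⟨⟨a, b⟩, hN⟩ := (hc.eventually_lt_const (show 0 < ε / 4 by linarith)).exists_forall_of_atTop
  set N := max a b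
  obtain ⟨M, hM0, hM⟩ := exists_bound_of_finite_range (hu N)
  obtain ⟨N', hN'⟩ := ((hm (ε / 4) (by linarith)).eventually_lt_const
    (show 0 < ε / (4 * (M + 1)) by positivity)).exists_forall_of_atTop
  refine ⟨max N N', fun n hn => ?_⟩
  rw [Real.dist_eq, sub_zero, abs_of_nonneg (hpos n)]
  have h1 := hN (n, N) ⟨(le_max_left a b).trans ((le_max_left _ _).trans hn), le_max_right a b⟩
  have h2 := hN' n ((le_max_right _ _).trans hn)
  set A := {ω | ε / 4 ≤ |u n ω|}
  have hd := finite_range_comp₂ (hu n) (hu N) fun x y => |x - y|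
  have hA : (Set.range fun ω => M * A.indicator (fun _ => (1 : ℝ)) ω).Finite :=
    finite_range_comp (finite_range_indicator A 1) fun x => M * x
  have hsum := finite_range_comp₂ hd hA fun x y => x + y
  -- Pointwise `|u n| ≤ |u n - u N| + M 1_A + ε / 4`: on `A` because `|u N| ≤ M`, off `A` by
  -- definition of `A`. The first two terms integrate to at most `ε / 4` each.
  have key := μ.simpleIntegral_mono (finite_range_comp (hu n) fun x => |x|)
    (finite_range_comp₂ hsum (finite_range_const (ε / 4)) fun x y => x + y) fun ω => by
      by_cases h : ω ∈ A
      · have := hM ω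
        have := abs_sub_abs_le_abs_sub (u n ω) (u N ω)
        simp only [h, Set.indicator_of_mem]
        linarith
      · have h' : |u n ω| < ε / 4 := not_le.1 h
        have := abs_nonneg (u n ω - u N ω)
        simp only [h, not_false_eq_true, Set.indicator_of_notMem]
        linarith
  rw [μ.simpleIntegral_add hsum (finite_range_const _), μ.simpleIntegral_add hd hA,
    μ.simpleIntegral_smul (finite_range_indicator A 1), μ.simpleIntegral_indicator,
    μ.simpleIntegral_const] at key
  have h3 : M * μ.mass A ≤ ε / 4 := by
    rw [lt_div_iff₀ (by positivity)] at h2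
    nlinarith [μ.mass_nonneg A]
  linarith

/-- One Lipschitz estimate covers sums, multiples, absolute values and minima at once. -/
theorem IsDetermining.comp₂ {s t : ℕ → Ω → ℝ} {f g : Ω → ℝ} (hs : μ.IsDetermining s f)
    (ht : μ.IsDetermining t g) {F : ℝ → ℝ → ℝ} {K : ℝ} (hK : 0 < K)
    (hF : ∀ x y x' y', |F x y - F x' y'| ≤ K * (|x - x'| + |y - y'|)) :
    μ.IsDetermining (fun n ω => F (s n ω) (t n ω)) (fun ω => F (f ω) (g ω)) where
  simple n := finite_range_comp₂ (hs.simple n) (ht.simple n) F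
  tendsto_in_measure ε hε := by
    have h := (hs.tendsto_in_measure (ε / (2 * K)) (by positivity)).add
      (ht.tendsto_in_measure (ε / (2 * K)) (by positivity))
    rw [add_zero] at h
    refine squeeze_zero (fun n => μ.mass_nonneg _) (fun n => ?_) h
    refine (μ.mass_mono ?_).trans (μ.mass_union_le _ _)
    intro ω hω
    by_contra hcon
    simp only [Set.mem_union, Set.mem_ofPred_eq, not_or, not_le] at hcon hω
    have := hF (f ω) (g ω) (s n ω) (t n ω)
    have h3 : K * (|f ω - s n ω| + |g ω - t n ω|) < K * (ε / (2 * K) + ε / (2 * K)) := by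
      gcongr
      exacts [hcon.1, hcon.2]
    have h4 : K * (ε / (2 * K) + ε / (2 * K)) = ε := by field_simp; ring
    linarith
  cauchy := by
    have h := (hs.cauchy.add ht.cauchy).const_mul K
    rw [add_zero, mul_zero] at h
    refine squeeze_zero (fun p => μ.simpleIntegral_nonneg fun ω => abs_nonneg _) (fun p => ?_) h
    have h1 := finite_range_comp₂ (hs.simple p.1) (hs.simple p.2) fun x y => |x - y|
    have h2 := finite_range_comp₂ (ht.simple p.1) (ht.simple p.2) fun x y => |x - y|
    have h3 := finite_range_comp₂ h1 h2 fun x y => x + y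
    rw [← μ.simpleIntegral_add h1 h2, ← μ.simpleIntegral_smul h3]
    exact μ.simpleIntegral_mono
      (finite_range_comp₂ (finite_range_comp₂ (hs.simple p.1) (ht.simple p.1) F)
        (finite_range_comp₂ (hs.simple p.2) (ht.simple p.2) F) fun x y => |x - y|)
      (finite_range_comp h3 fun x => K * x) fun ω => hF _ _ _ _

theorem IsDetermining.add {s t : ℕ → Ω → ℝ} {f g : Ω → ℝ} (hs : μ.IsDetermining s f)
    (ht : μ.IsDetermining t g) :
    μ.IsDetermining (fun n ω => s n ω + t n ω) (fun ω => f ω + g ω) :=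
  hs.comp₂ ht (F := fun x y => x + y) one_pos fun x y x' y' => by
    rw [one_mul, add_sub_add_comm]; exact abs_add_le _ _

theorem IsDetermining.const_mul {s : ℕ → Ω → ℝ} {f : Ω → ℝ} (hs : μ.IsDetermining s f) (c : ℝ) :
    μ.IsDetermining (fun n ω => c * s n ω) (fun ω => c * f ω) :=
  hs.comp₂ hs (F := fun x _ => c * x) (K := |c| + 1) (by positivity) fun x y x' y' => by
    rw [← mul_sub, abs_mul]
    nlinarith [abs_nonneg c, abs_nonneg (x - x'), abs_nonneg (y - y'),
      mul_nonneg (abs_nonneg c) (abs_nonneg (y - y'))]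

theorem IsDetermining.abs {s : ℕ → Ω → ℝ} {f : Ω → ℝ} (hs : μ.IsDetermining s f) :
    μ.IsDetermining (fun n ω => |s n ω|) (fun ω => |f ω|) :=
  hs.comp₂ hs (F := fun x _ => |x|) one_pos fun x y x' y' => by
    have := abs_abs_sub_abs_le x x'
    linarith [abs_nonneg (y - y')]

theorem IsDetermining.inf {s t : ℕ → Ω → ℝ} {f g : Ω → ℝ} (hs : μ.IsDetermining s f)
    (ht : μ.IsDetermining t g) :
    μ.IsDetermining (fun n ω => min (s n ω) (t n ω)) (fun ω => min (f ω) (g ω)) :=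
  hs.comp₂ ht (F := fun x y => min x y) one_pos fun x y x' y' => by
    have := abs_min_sub_min_le_max x y x' y'
    have := max_le_add_of_nonneg (abs_nonneg (x - x')) (abs_nonneg (y - y'))
    linarith

theorem IsDetermining.congr {s : ℕ → Ω → ℝ} {f g : Ω → ℝ} (hs : μ.IsDetermining s f)
    (h : ∀ ε : ℝ, 0 < ε → μ.mass {ω | ε ≤ |f ω - g ω|} = 0) : μ.IsDetermining s g where
  simple := hs.simple
  cauchy := hs.cauchy
  tendsto_in_measure ε hε := by
    refine squeeze_zero (fun n => μ.mass_nonneg _) (fun n => ?_)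
      (hs.tendsto_in_measure (ε / 2) (by linarith))
    have h1 : {ω | ε ≤ |g ω - s n ω|} ⊆ {ω | ε / 2 ≤ |f ω - s n ω|} ∪ {ω | ε / 2 ≤ |f ω - g ω|} := by
      intro ω hω
      by_contra hcon
      simp only [Set.mem_union, Set.mem_ofPred_eq, not_or, not_le] at hcon hω
      have := abs_sub_le (g ω) (f ω) (s n ω)
      rw [abs_sub_comm (g ω) (f ω)] at this
      linarith
    have := (μ.mass_mono h1).trans (μ.mass_union_le _ _)
    rwa [h (ε / 2) (by linarith), add_zero] at this

theorem isDetermining_const {s : Ω → ℝ} (hs : (Set.range s).Finite) :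
    μ.IsDetermining (fun _ => s) s where
  simple _ := hs
  tendsto_in_measure ε hε := by simp [hε.not_ge, mass_empty]
  cauchy := by simp [simpleIntegral_const]

/-- The differences `s n - t n` form a determining sequence for `0`, so their `L¹` norms vanish in
the limit; this makes the integral well defined. -/
theorem IsDetermining.unique {s t : ℕ → Ω → ℝ} {f : Ω → ℝ} (hs : μ.IsDetermining s f)
    (ht : μ.IsDetermining t f) :
    Tendsto (fun n => μ.simpleIntegral fun ω => |s n ω - t n ω|) atTop (𝓝 0) := by
  have h := hs.comp₂ ht (F := fun x y => x - y) one_pos fun x y x' y' => by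
    rw [one_mul, sub_sub_sub_comm]; exact abs_sub _ _
  refine simpleIntegral_abs_tendsto_zero h.simple (fun ε hε => ?_) h.cauchy
  simpa [abs_sub_comm] using h.tendsto_in_measure ε hε

theorem IsDetermining.exists_hasIntegral {s : ℕ → Ω → ℝ} {f : Ω → ℝ} (hs : μ.IsDetermining s f) :
    ∃ I, Tendsto (fun n => μ.simpleIntegral (s n)) atTop (𝓝 I) := by
  refine cauchySeq_tendsto_of_complete ?_
  rw [Metric.cauchySeq_iff']
  intro ε hε
  obtain ⟨⟨a, b⟩, hN⟩ := (hs.cauchy.eventually_lt_const hε).exists_forall_of_atTop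
  refine ⟨max a b, fun n hn => ?_⟩
  rw [Real.dist_eq]
  exact (μ.abs_simpleIntegral_sub_le (hs.simple _) (hs.simple _)).trans_lt
    (hN (n, max a b) ⟨(le_max_left _ _).trans hn, le_max_right _ _⟩)

theorem HasIntegral.unique {f : Ω → ℝ} {I J : ℝ} (hI : μ.HasIntegral f I)
    (hJ : μ.HasIntegral f J) : I = J := by
  obtain ⟨s, hs, hsI⟩ := hI
  obtain ⟨t, ht, htJ⟩ := hJ
  have h : Tendsto (fun n => μ.simpleIntegral (s n) - μ.simpleIntegral (t n)) atTop (𝓝 0) :=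
    squeeze_zero_norm (fun n => μ.abs_simpleIntegral_sub_le (hs.simple n) (ht.simple n))
      (hs.unique ht)
  exact sub_eq_zero.1 (tendsto_nhds_unique (hsI.sub htJ) h)

theorem HasIntegral.integral_eq {f : Ω → ℝ} {I : ℝ} (h : μ.HasIntegral f I) :
    μ.integral f = I := by
  have h' : ∃ I, μ.HasIntegral f I := ⟨I, h⟩
  rw [integral, dif_pos h']
  exact h'.choose_spec.unique h

theorem IsDetermining.tendsto {s : ℕ → Ω → ℝ} {f : Ω → ℝ} (hs : μ.IsDetermining s f) :
    Tendsto (fun n => μ.simpleIntegral (s n)) atTop (𝓝 (μ.integral f)) := by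
  obtain ⟨I, hI⟩ := hs.exists_hasIntegral
  rwa [HasIntegral.integral_eq ⟨s, hs, hI⟩]

/-! ### The space `L¹` -/

theorem L1_add {f g : Ω → ℝ} (hf : f ∈ μ.L1) (hg : g ∈ μ.L1) : (fun ω => f ω + g ω) ∈ μ.L1 :=
  let ⟨_, hs⟩ := hf
  let ⟨_, ht⟩ := hg
  ⟨_, hs.add ht⟩

theorem L1_const_mul {f : Ω → ℝ} (hf : f ∈ μ.L1) (c : ℝ) : (fun ω => c * f ω) ∈ μ.L1 :=
  let ⟨_, hs⟩ := hf
  ⟨_, hs.const_mul c⟩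

theorem L1_abs {f : Ω → ℝ} (hf : f ∈ μ.L1) : (fun ω => |f ω|) ∈ μ.L1 :=
  let ⟨_, hs⟩ := hf
  ⟨_, hs.abs⟩

theorem L1_min {f g : Ω → ℝ} (hf : f ∈ μ.L1) (hg : g ∈ μ.L1) :
    (fun ω => min (f ω) (g ω)) ∈ μ.L1 :=
  let ⟨_, hs⟩ := hf
  let ⟨_, ht⟩ := hg
  ⟨_, hs.inf ht⟩

theorem L1_simple {s : Ω → ℝ} (hs : (Set.range s).Finite) : s ∈ μ.L1 :=
  ⟨_, isDetermining_const hs⟩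

theorem L1_const (c : ℝ) : (fun _ => c) ∈ μ.L1 := L1_simple (finite_range_const c)

theorem L1_sub {f g : Ω → ℝ} (hf : f ∈ μ.L1) (hg : g ∈ μ.L1) : (fun ω => f ω - g ω) ∈ μ.L1 := by
  convert L1_add hf (L1_const_mul hg (-1)) using 2
  ring

theorem integral_add {f g : Ω → ℝ} (hf : f ∈ μ.L1) (hg : g ∈ μ.L1) :
    μ.integral (fun ω => f ω + g ω) = μ.integral f + μ.integral g := by
  obtain ⟨s, hs⟩ := hf
  obtain ⟨t, ht⟩ := hg
  refine tendsto_nhds_unique (hs.add ht).tendsto ((hs.tendsto.add ht.tendsto).congr fun n => ?_)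
  rw [μ.simpleIntegral_add (hs.simple n) (ht.simple n)]

theorem integral_const_mul {f : Ω → ℝ} (hf : f ∈ μ.L1) (c : ℝ) :
    μ.integral (fun ω => c * f ω) = c * μ.integral f := by
  obtain ⟨s, hs⟩ := hf
  refine tendsto_nhds_unique (hs.const_mul c).tendsto ((hs.tendsto.const_mul c).congr fun n => ?_)
  rw [μ.simpleIntegral_smul (hs.simple n)]

theorem integral_sub {f g : Ω → ℝ} (hf : f ∈ μ.L1) (hg : g ∈ μ.L1) :
    μ.integral (fun ω => f ω - g ω) = μ.integral f - μ.integral g := by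
  have := integral_add hf (L1_const_mul hg (-1))
  rw [integral_const_mul hg] at this
  convert this using 1
  · congr 1; ext ω; ring
  · ring

theorem integral_simple {s : Ω → ℝ} (hs : (Set.range s).Finite) :
    μ.integral s = μ.simpleIntegral s :=
  HasIntegral.integral_eq ⟨_, isDetermining_const hs, tendsto_const_nhds⟩

theorem integral_const (c : ℝ) : μ.integral (fun _ => c) = c := by
  rw [integral_simple (finite_range_const c), simpleIntegral_const]

theorem integral_indicator (A : Set Ω) : μ.integral (A.indicator fun _ => 1) = μ.mass A := by
  rw [integral_simple (finite_range_indicator A 1), simpleIntegral_indicator]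

/-- Nonnegativity of `f` up to `μ`-null functions. -/
def AENonneg (μ : FinAddProb Ω) (f : Ω → ℝ) : Prop :=
  ∀ ε : ℝ, 0 < ε → μ.mass {ω | f ω ≤ -ε} = 0

theorem AENonneg.of_nonneg {f : Ω → ℝ} (h : ∀ ω, 0 ≤ f ω) : μ.AENonneg f := by
  intro ε hε
  have : {ω | f ω ≤ -ε} = ∅ := Set.eq_empty_of_forall_notMem fun ω hω => by
    have := h ω
    simp only [Set.mem_ofPred_eq] at hω
    linarith
  rw [this, mass_empty]

theorem integral_nonneg {f : Ω → ℝ} (hf : f ∈ μ.L1) (h : μ.AENonneg f) : 0 ≤ μ.integral f := by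
  obtain ⟨s, hs⟩ := hf
  -- `f` and `|f|` differ by a null function, so the nonnegative functions `|s n|` also determine
  -- `f`.
  have habs : μ.IsDetermining (fun n ω => |s n ω|) f := hs.abs.congr fun ε hε => by
    refine μ.mass_eq_zero_of_subset (fun ω hω => ?_) (h (ε / 2) (by linarith))
    simp only [Set.mem_ofPred_eq] at hω ⊢
    by_contra hcon
    rcases le_total 0 (f ω) with h0 | h0
    · simp only [abs_of_nonneg h0, sub_self, abs_zero] at hω
      linarith
    · rw [abs_of_nonpos h0, abs_of_nonneg (by linarith)] at hω
      linarith
  exact ge_of_tendsto' habs.tendsto fun n => μ.simpleIntegral_nonneg fun ω => abs_nonneg _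

theorem integral_mono_ae {f g : Ω → ℝ} (hf : f ∈ μ.L1) (hg : g ∈ μ.L1)
    (h : μ.AENonneg fun ω => g ω - f ω) : μ.integral f ≤ μ.integral g := by
  have := integral_nonneg (L1_sub hg hf) h
  rw [integral_sub hg hf] at this
  linarith

theorem integral_mono {f g : Ω → ℝ} (hf : f ∈ μ.L1) (hg : g ∈ μ.L1) (h : ∀ ω, f ω ≤ g ω) :
    μ.integral f ≤ μ.integral g :=
  integral_mono_ae hf hg (AENonneg.of_nonneg fun ω => sub_nonneg.2 (h ω))

theorem IsDetermining.tendsto_integral_abs_sub {s : ℕ → Ω → ℝ} {f : Ω → ℝ}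
    (hs : μ.IsDetermining s f) :
    Tendsto (fun n => μ.integral fun ω => |f ω - s n ω|) atTop (𝓝 0) := by
  rw [Metric.tendsto_atTop]
  intro ε hε
  obtain ⟨⟨a, b⟩, hN⟩ := (hs.cauchy.eventually_lt_const (half_pos hε)).exists_forall_of_atTop
  refine ⟨max a b, fun n hn => ?_⟩
  -- For fixed `n`, the functions `|s k - s n|` determine `|f - s n|` as `k` grows, so the Cauchy
  -- bound passes to the limit.
  have hd := (hs.comp₂ (isDetermining_const (hs.simple n)) (F := fun x y => |x - y|) one_pos
    fun x y x' y' => by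
      have := abs_abs_sub_abs_le (x - y) (x' - y')
      rw [sub_sub_sub_comm] at this
      have := abs_sub (x - x') (y - y')
      linarith).tendsto
  have hle : μ.integral (fun ω => |f ω - s n ω|) ≤ ε / 2 := by
    refine le_of_tendsto hd (eventually_atTop.2 ⟨max a b, fun k hk => ?_⟩)
    exact (hN (k, n) ⟨(le_max_left _ _).trans hk, (le_max_right _ _).trans hn⟩).le
  have h0 : 0 ≤ μ.integral (fun ω => |f ω - s n ω|) :=
    integral_nonneg (L1_abs (L1_sub ⟨s, hs⟩ (L1_simple (hs.simple n))))
      (AENonneg.of_nonneg fun ω => abs_nonneg _)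
  rw [Real.dist_eq, sub_zero, abs_of_nonneg h0]
  linarith

/-! ### Chebyshev's inequality, approximation and domination in `L¹` -/

theorem mass_mul_le_integral {f : Ω → ℝ} (hf : f ∈ μ.L1) (h0 : ∀ ω, 0 ≤ f ω) {ε : ℝ}
    (hε : 0 < ε) : μ.mass {ω | ε ≤ f ω} ≤ μ.integral f / ε := by
  rw [le_div_iff₀ hε, mul_comm, ← integral_indicator,
    ← integral_const_mul (L1_simple (finite_range_indicator _ 1))]
  refine integral_mono (L1_const_mul (L1_simple (finite_range_indicator _ 1)) _) hf fun ω => ?_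
  by_cases h : ω ∈ {ω | ε ≤ f ω}
  · rw [Set.indicator_of_mem h, mul_one]
    exact h
  · simpa [h] using h0 ω

/-- The error is controlled through an integrable majorant `F`, since `|f - t|` is not yet known to
be integrable and `integral` could then be the default `0`. -/
theorem mem_L1_of_approx {f : Ω → ℝ} (h : ∀ ε : ℝ, 0 < ε → ∃ t F : Ω → ℝ, (Set.range t).Finite ∧
    F ∈ μ.L1 ∧ (∀ ω, |f ω - t ω| ≤ F ω) ∧ μ.integral F < ε) : f ∈ μ.L1 := by
  choose t F ht hF hle hint using fun n : ℕ => h (1 / (n + 1)) (by positivity)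
  have h0 : ∀ n ω, 0 ≤ F n ω := fun n ω => (abs_nonneg _).trans (hle n ω)
  have hlim : Tendsto (fun n => μ.integral (F n)) atTop (𝓝 0) :=
    squeeze_zero (fun n => integral_nonneg (hF n) (AENonneg.of_nonneg (h0 n)))
      (fun n => (hint n).le) tendsto_one_div_add_atTop_nhds_zero_nat
  refine ⟨t, ht, fun ε hε => ?_, ?_⟩
  · have h2 := hlim.div_const ε
    rw [zero_div] at h2
    refine squeeze_zero (fun n => μ.mass_nonneg _) (fun n => ?_) h2
    exact (μ.mass_mono fun ω hω => le_trans hω (hle n ω)).trans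
      (mass_mul_le_integral (hF n) (h0 n) hε)
  · have h2 := (hlim.comp tendsto_fst).add (hlim.comp tendsto_snd)
    rw [add_zero, prod_atTop_atTop_eq] at h2
    refine squeeze_zero (fun p => μ.simpleIntegral_nonneg fun ω => abs_nonneg _) (fun p => ?_) h2
    have hd := finite_range_comp₂ (ht p.1) (ht p.2) fun x y => |x - y|
    rw [← integral_simple hd]
    simp only [Function.comp_apply]
    rw [← integral_add (hF _) (hF _)]
    refine integral_mono (L1_simple hd) (L1_add (hF _) (hF _)) fun ω => ?_
    have h3 := abs_sub_le (t p.1 ω) (f ω) (t p.2 ω)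
    rw [abs_sub_comm (t p.1 ω) (f ω)] at h3
    linarith [hle p.1 ω, hle p.2 ω]

theorem exists_simple_near_of_bounded {f : Ω → ℝ} {M : ℝ} (hM : ∀ ω, |f ω| ≤ M) {ε : ℝ}
    (hε : 0 < ε) : ∃ t : Ω → ℝ, (Set.range t).Finite ∧ ∀ ω, |f ω - t ω| ≤ ε := by
  refine ⟨fun ω => ε * ⌊f ω / ε⌋, ?_, fun ω => ?_⟩
  · refine ((Set.finite_Icc ⌊-M / ε⌋ ⌊M / ε⌋).image fun k : ℤ => ε * (k : ℝ)).subset ?_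
    rintro _ ⟨ω, rfl⟩
    have := abs_le.1 (hM ω)
    exact ⟨⌊f ω / ε⌋, ⟨by gcongr; exact this.1, by gcongr; exact this.2⟩, rfl⟩
  · have h1 := Int.floor_le (f ω / ε)
    have h2 := Int.lt_floor_add_one (f ω / ε)
    rw [le_div_iff₀ hε] at h1
    rw [div_lt_iff₀ hε] at h2
    exact abs_le.2 ⟨by linarith, by linarith⟩

/-- If a simple `s n` bounded by `M` is `L¹`-close to `F`, cutting `f` at `±M` costs at most `|F - s
n|`. The truncation is bounded, hence a uniform limit of simple functions; every set is measurable,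
so nothing else is required of `f`. -/
theorem L1_of_abs_le {f F : Ω → ℝ} (hF : F ∈ μ.L1) (hle : ∀ ω, |f ω| ≤ F ω) : f ∈ μ.L1 := by
  refine mem_L1_of_approx fun ε hε => ?_
  obtain ⟨s, hs⟩ := hF
  obtain ⟨n, hn⟩ := (hs.tendsto_integral_abs_sub.eventually_lt_const (half_pos hε)).exists
  obtain ⟨M, hM0, hM⟩ := exists_bound_of_finite_range (hs.simple n)
  obtain ⟨t, ht, htf⟩ := exists_simple_near_of_bounded (f := fun ω => max (-M) (min (f ω) M))
    (M := M) (fun ω => abs_le.2 ⟨le_max_left _ _, max_le (by linarith) (min_le_right _ _)⟩)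
    (half_pos hε)
  have hd : (fun ω => |F ω - s n ω|) ∈ μ.L1 := L1_abs (L1_sub ⟨s, hs⟩ (L1_simple (hs.simple n)))
  refine ⟨t, fun ω => |F ω - s n ω| + ε / 2, ht, L1_add hd (L1_const _), fun ω => ?_, ?_⟩
  · have h1 := htf ω
    have h2 := abs_sub_le (f ω) (max (-M) (min (f ω) M)) (t ω)
    have h3 : |f ω - max (-M) (min (f ω) M)| ≤ |F ω - s n ω| := by
      have h4 := abs_le.1 (hle ω)
      have h5 := abs_le.1 (hM ω)
      have h6 := le_abs_self (F ω - s n ω)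
      rcases le_total (f ω) M with h | h
      · rw [min_eq_left h]
        rcases le_total (-M) (f ω) with h' | h'
        · simp [max_eq_right h']
        · rw [max_eq_left h', abs_of_nonpos (by linarith)]
          linarith
      · rw [min_eq_right h, max_eq_right (by linarith), abs_of_nonneg (by linarith)]
        linarith
    linarith
  · rw [integral_add hd (L1_const _), integral_const]
    linarith

theorem L1_of_null {f : Ω → ℝ} (h : ∀ ε : ℝ, 0 < ε → μ.mass {ω | ε ≤ |f ω|} = 0) : f ∈ μ.L1 :=
  ⟨_, (isDetermining_const (finite_range_const 0)).congr fun ε hε => by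
    simpa using h ε hε⟩

theorem L1_of_abs_le_ae {f F : Ω → ℝ} (hF : F ∈ μ.L1) (hle : μ.AENonneg fun ω => F ω - |f ω|) :
    f ∈ μ.L1 := by
  set g : Ω → ℝ := fun ω => max (-|F ω|) (min (f ω) |F ω|)
  have hg : g ∈ μ.L1 := L1_of_abs_le (L1_abs hF) fun ω => abs_le.2
    ⟨le_max_left _ _, max_le (by linarith [abs_nonneg (F ω)]) (min_le_right _ _)⟩
  have hd : (fun ω => f ω - g ω) ∈ μ.L1 := L1_of_null fun ε hε => by
    refine μ.mass_eq_zero_of_subset (fun ω hω => ?_) (hle ε hε)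
    simp only [Set.mem_ofPred_eq, g] at hω ⊢
    have h0 := abs_nonneg (F ω)
    have h1 := le_abs_self (F ω)
    have h2 := le_abs_self (f ω)
    have h3 := neg_abs_le (f ω)
    rcases le_total (f ω) |F ω| with h | h
    · rw [min_eq_left h] at hω
      rcases le_total (-|F ω|) (f ω) with h' | h'
      · simp only [max_eq_right h', sub_self, abs_zero] at hω
        linarith
      · rw [max_eq_left h', abs_of_nonpos (by linarith)] at hω
        linarith
    · rw [min_eq_right h, max_eq_right (by linarith), abs_of_nonneg (by linarith)] at hω
      linarith
  convert L1_add hg hd using 2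
  ring

theorem L1_of_bounded {f : Ω → ℝ} {M : ℝ} (hM : ∀ ω, |f ω| ≤ M) : f ∈ μ.L1 :=
  L1_of_abs_le (L1_const M) hM

variable (μ) in
/-- `L¹(μ)` as a vector space. -/
def L1Submodule : Submodule ℝ (Ω → ℝ) where
  carrier := μ.L1
  add_mem' hf hg := L1_add hf hg
  zero_mem' := L1_const 0
  smul_mem' c _ hf := L1_const_mul hf c

theorem IsDetermining.of_mass_le {ν : FinAddProb Ω} {K : ℝ} (h : ∀ A, ν.mass A ≤ K * μ.mass A)
    {s : ℕ → Ω → ℝ} {f : Ω → ℝ} (hs : μ.IsDetermining s f) : ν.IsDetermining s f where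
  simple := hs.simple
  tendsto_in_measure ε hε := by
    have h1 := (hs.tendsto_in_measure ε hε).const_mul K
    rw [mul_zero] at h1
    exact squeeze_zero (fun n => ν.mass_nonneg _) (fun n => h _) h1
  cauchy := by
    have h1 := hs.cauchy.const_mul K
    rw [mul_zero] at h1
    exact squeeze_zero (fun n => ν.simpleIntegral_nonneg fun ω => abs_nonneg _)
      (fun p => μ.simpleIntegral_le_mul h
        (finite_range_comp₂ (hs.simple p.1) (hs.simple p.2) fun x y => |x - y|)
        fun ω => abs_nonneg _) h1

end FinAddProb

end

noncomputable section

/-! ### Separation in `L¹` and exhaustion -/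

namespace FinAddProb

variable {Ω : Type*} {μ : FinAddProb Ω}

variable (μ) in
/-- The linear functionals on `L¹(μ)` dominated by the `L¹` seminorm and nonpositive on `C`. -/
def separatingFunctionals (C : Set (Ω → ℝ)) : Set (μ.L1Submodule →ₗ[ℝ] ℝ) :=
  {φ | (∀ h : μ.L1Submodule, φ h ≤ μ.integral fun ω => |(h : Ω → ℝ) ω|) ∧
    ∀ h : μ.L1Submodule, (h : Ω → ℝ) ∈ C → φ h ≤ 0}

variable (μ) in
/-- The indicator function of `A` as an element of `L¹(μ)`. -/
def indicatorL1 (A : Set Ω) : μ.L1Submodule :=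
  ⟨A.indicator fun _ => 1, L1_simple (finite_range_indicator A 1)⟩

/-- A convex cone that contains all nonpositive functions. -/
structure IsSolidCone (C : Set (Ω → ℝ)) : Prop where
  add_mem : ∀ f ∈ C, ∀ g ∈ C, f + g ∈ C
  smul_mem : ∀ c : ℝ, 0 < c → ∀ f ∈ C, c • f ∈ C
  mem_of_nonpos : ∀ f : Ω → ℝ, (∀ ω, f ω ≤ 0) → f ∈ C

theorem integral_abs_sub_le_add {f g f' g' : Ω → ℝ} (hf : f ∈ μ.L1) (hg : g ∈ μ.L1)
    (hf' : f' ∈ μ.L1) (hg' : g' ∈ μ.L1) :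
    μ.integral (fun ω => |(f + f') ω - (g + g') ω|) ≤
      μ.integral (fun ω => |f ω - g ω|) + μ.integral (fun ω => |f' ω - g' ω|) := by
  have h1 := L1_abs (L1_sub hf hg)
  have h2 := L1_abs (L1_sub hf' hg')
  rw [← integral_add h1 h2]
  refine integral_mono (L1_abs (L1_sub (L1_add hf hf') (L1_add hg hg'))) (L1_add h1 h2) fun ω => ?_
  simp only [Pi.add_apply, add_sub_add_comm]
  exact abs_add_le _ _

theorem integral_abs_smul_sub {f g : Ω → ℝ} (hf : f ∈ μ.L1) (hg : g ∈ μ.L1) {c : ℝ} (hc : 0 < c) :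
    μ.integral (fun ω => |(c • f) ω - (c • g) ω|) = c * μ.integral (fun ω => |f ω - g ω|) := by
  rw [← integral_const_mul (L1_abs (L1_sub hf hg))]
  congr 1
  ext ω
  rw [Pi.smul_apply, Pi.smul_apply, smul_eq_mul, smul_eq_mul, ← mul_sub, abs_mul, abs_of_pos hc]

theorem integral_abs_nonneg {f : Ω → ℝ} (hf : f ∈ μ.L1) : 0 ≤ μ.integral fun ω => |f ω| :=
  integral_nonneg (L1_abs hf) (AENonneg.of_nonneg fun _ => abs_nonneg _)

theorem exists_separatingFunctional_pos {C : Set (Ω → ℝ)} (hC : IsSolidCone C)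
    (f : μ.L1Submodule) (hf : (f : Ω → ℝ) ∉ μ.closureL1 C) :
    ∃ φ ∈ μ.separatingFunctionals C, 0 < φ f := by
  let I := {g : μ.L1Submodule // (g : Ω → ℝ) ∈ C}
  let p : μ.L1Submodule → I → ℝ := fun h g => μ.integral fun ω => |(h : Ω → ℝ) ω - (g.1 : Ω → ℝ) ω|
  have h0C : (0 : Ω → ℝ) ∈ C := hC.mem_of_nonpos 0 fun _ => le_rfl
  let z : I := ⟨0, h0C⟩
  have : Nonempty I := ⟨z⟩
  have hp0 : ∀ h g, 0 ≤ p h g := fun h g => integral_abs_nonneg (L1_sub h.2 g.1.2)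
  have hbdd : ∀ h, BddBelow (Set.range (p h)) := fun h => ⟨0, by rintro _ ⟨g, rfl⟩; exact hp0 h g⟩
  -- The `L¹` distance to the integrable part of the cone `C` is sublinear; it vanishes on `C` and
  -- is at most the seminorm because `0 ∈ C`.
  let q : μ.L1Submodule → ℝ := fun h => ⨅ g, p h g
  have hq0 : ∀ h, 0 ≤ q h := fun h => Real.iInf_nonneg (hp0 h)
  have hqle : ∀ h g, q h ≤ p h g := fun h g => ciInf_le (hbdd h) g
  have hqC : ∀ h : μ.L1Submodule, (h : Ω → ℝ) ∈ C → q h ≤ 0 := fun h hh => by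
    refine (hqle h ⟨h, hh⟩).trans_eq ?_
    simp only [p, sub_self, abs_zero]
    exact integral_const 0
  have hsmul_le : ∀ c : ℝ, 0 < c → ∀ h, q (c • h) ≤ c * q h := fun c hc h => by
    rw [← div_le_iff₀' hc]
    refine le_ciInf fun g => ?_
    rw [div_le_iff₀' hc]
    refine (hqle (c • h) ⟨c • g.1, hC.smul_mem c hc _ g.2⟩).trans_eq ?_
    exact integral_abs_smul_sub h.2 g.1.2 hc
  have hsmul : ∀ c : ℝ, 0 < c → ∀ h, q (c • h) = c * q h := fun c hc h => by
    refine le_antisymm (hsmul_le c hc h) ?_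
    have := hsmul_le c⁻¹ (inv_pos.2 hc) (c • h)
    rwa [inv_smul_smul₀ hc.ne', inv_mul_eq_div, le_div_iff₀' hc] at this
  have hadd : ∀ h h', q (h + h') ≤ q h + q h' := fun h h' => by
    rw [← sub_le_iff_le_add]
    refine le_ciInf fun g => ?_
    rw [sub_le_comm]
    refine le_ciInf fun g' => ?_
    rw [sub_le_iff_le_add']
    refine (hqle (h + h') ⟨g.1 + g'.1, hC.add_mem _ g.2 _ g'.2⟩).trans ?_
    exact integral_abs_sub_le_add h.2 g.1.2 h'.2 g'.1.2
  have hδ : 0 < q f := by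
    simp only [closureL1, Set.mem_ofPred_eq, not_and, not_forall] at hf
    obtain ⟨ε, hε, hne⟩ := hf f.2
    refine hε.trans_le (le_ciInf fun g => not_lt.1 fun hlt => hne ⟨g.1, g.2, g.1.2, hlt⟩)
  have hf0 : f ≠ 0 := by
    rintro rfl
    exact hδ.not_ge (hqC 0 h0C)
  -- Hahn–Banach extends the functional `c f ↦ c q(f)` from the line spanned by `f`.
  obtain ⟨φ, hφ, hle⟩ := exists_extension_of_le_sublinear
    (LinearPMap.mkSpanSingleton f (q f) hf0) q hsmul hadd (by
      rintro ⟨x, hx⟩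
      obtain ⟨c, rfl⟩ := Submodule.mem_span_singleton.1 hx
      have : (LinearPMap.mkSpanSingleton f (q f) hf0) ⟨c • f, hx⟩ = c • q f :=
        LinearPMap.mkSpanSingleton'_apply _ _ _ _ _
      rw [this]
      rcases le_or_gt c 0 with hc | hc
      · exact (smul_nonpos_of_nonpos_of_nonneg hc hδ.le).trans (hq0 _)
      · exact (hsmul c hc f).ge)
  refine ⟨φ, ⟨fun h => (hle h).trans ((hqle h z).trans_eq ?_), fun h hh => (hle h).trans (hqC h hh)⟩,
    ?_⟩
  · simp [p, z]
  · have h1 := hφ ⟨f, Submodule.mem_span_singleton_self f⟩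
    rw [LinearPMap.mkSpanSingleton_apply] at h1
    rwa [h1]

section

variable {C : Set (Ω → ℝ)} {φ ψ : μ.L1Submodule →ₗ[ℝ] ℝ}

theorem abs_separatingFunctional_le (hφ : φ ∈ μ.separatingFunctionals C) (h : μ.L1Submodule) :
    |φ h| ≤ μ.integral fun ω => |(h : Ω → ℝ) ω| := by
  refine abs_le.2 ⟨?_, hφ.1 h⟩
  have := hφ.1 (-h)
  simp only [map_neg, Submodule.coe_neg, Pi.neg_apply, abs_neg] at this
  linarith

theorem separatingFunctional_nonneg (hC : IsSolidCone C) (hφ : φ ∈ μ.separatingFunctionals C)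
    (h : μ.L1Submodule) (h0 : ∀ ω, 0 ≤ (h : Ω → ℝ) ω) : 0 ≤ φ h := by
  have := hφ.2 (-h) (hC.mem_of_nonpos _ fun ω => neg_nonpos.2 (h0 ω))
  rw [map_neg] at this
  linarith

theorem separatingFunctional_mono (hC : IsSolidCone C) (hφ : φ ∈ μ.separatingFunctionals C)
    (h h' : μ.L1Submodule) (hle : ∀ ω, (h : Ω → ℝ) ω ≤ (h' : Ω → ℝ) ω) : φ h ≤ φ h' := by
  have := separatingFunctional_nonneg hC hφ (h' - h) fun ω => sub_nonneg.2 (hle ω)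
  rw [map_sub] at this
  linarith

theorem indicator_const_nonneg (A : Set Ω) (ω : Ω) : 0 ≤ A.indicator (fun _ => (1 : ℝ)) ω :=
  Set.indicator_nonneg (fun _ _ => zero_le_one) ω

theorem separatingFunctional_indicator_nonneg (hC : IsSolidCone C)
    (hφ : φ ∈ μ.separatingFunctionals C) (A : Set Ω) : 0 ≤ φ (μ.indicatorL1 A) :=
  separatingFunctional_nonneg hC hφ _ fun ω => indicator_const_nonneg A ω

theorem separatingFunctional_indicator_le (hφ : φ ∈ μ.separatingFunctionals C) (A : Set Ω) :
    φ (μ.indicatorL1 A) ≤ μ.mass A := by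
  refine (hφ.1 _).trans_eq ?_
  rw [← integral_indicator]
  congr 1
  ext ω
  exact abs_of_nonneg (indicator_const_nonneg A ω)

theorem indicatorL1_union {A B : Set Ω} (h : Disjoint A B) :
    μ.indicatorL1 (A ∪ B) = μ.indicatorL1 A + μ.indicatorL1 B :=
  Subtype.ext (Set.indicator_union_of_disjoint h _)

theorem separatingFunctional_indicator_union (h : μ.L1Submodule →ₗ[ℝ] ℝ) {A B : Set Ω}
    (hd : Disjoint A B) :
    h (μ.indicatorL1 (A ∪ B)) = h (μ.indicatorL1 A) + h (μ.indicatorL1 B) := by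
  rw [indicatorL1_union hd, map_add]

theorem separatingFunctional_indicator_mono (hC : IsSolidCone C)
    (hφ : φ ∈ μ.separatingFunctionals C) {A B : Set Ω} (h : A ⊆ B) :
    φ (μ.indicatorL1 A) ≤ φ (μ.indicatorL1 B) :=
  separatingFunctional_mono hC hφ _ _ fun ω =>
    Set.indicator_le_indicator_of_subset h (fun _ => zero_le_one) ω

/-- The weights `2^{-(k+1)}` sum to `1`, so this countable convex combination keeps both the
seminorm bound and the sign on `C`. -/
theorem exists_hasSum_separatingFunctional {φ : ℕ → μ.L1Submodule →ₗ[ℝ] ℝ}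
    (hφ : ∀ k, φ k ∈ μ.separatingFunctionals C) :
    ∃ ψ ∈ μ.separatingFunctionals C, ∀ h, HasSum (fun k => 1 / 2 / 2 ^ k * φ k h) (ψ h) := by
  have hgeo : ∀ a : ℝ, HasSum (fun k : ℕ => 1 / 2 / 2 ^ k * a) a := fun a => by
    simpa using (hasSum_geometric_two' 1).mul_right a
  have hsum : ∀ h, Summable fun k => 1 / 2 / 2 ^ k * φ k h := fun h => by
    refine Summable.of_norm_bounded (hgeo (μ.integral fun ω => |(h : Ω → ℝ) ω|)).summable fun k => ?_
    rw [norm_mul, Real.norm_of_nonneg (by positivity)]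
    exact mul_le_mul_of_nonneg_left (abs_separatingFunctional_le (hφ k) h) (by positivity)
  let ψ : μ.L1Submodule →ₗ[ℝ] ℝ :=
    { toFun := fun h => ∑' k, 1 / 2 / 2 ^ k * φ k h
      map_add' := fun h h' => by
        simp only [map_add, mul_add]
        exact (hsum h).tsum_add (hsum h')
      map_smul' := fun c h => by
        simp only [map_smul, smul_eq_mul, RingHom.id_apply, ← tsum_mul_left]
        exact tsum_congr fun k => by ring }
  have hψ : ∀ h, HasSum (fun k => 1 / 2 / 2 ^ k * φ k h) (ψ h) := fun h => (hsum h).hasSum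
  refine ⟨ψ, ⟨fun h => ?_, fun h hh => ?_⟩, hψ⟩
  · exact hasSum_le (fun k => mul_le_mul_of_nonneg_left ((hφ k).1 h) (by positivity)) (hψ h)
      (hgeo _)
  · exact (hψ h).nonpos fun k =>
      mul_nonpos_of_nonneg_of_nonpos (by positivity) ((hφ k).2 h hh)

theorem midpoint_mem_separatingFunctionals (hφ : φ ∈ μ.separatingFunctionals C)
    (hψ : ψ ∈ μ.separatingFunctionals C) :
    (1 / 2 : ℝ) • (φ + ψ) ∈ μ.separatingFunctionals C := by
  refine ⟨fun h => ?_, fun h hh => ?_⟩ <;>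
    simp only [LinearMap.smul_apply, LinearMap.add_apply, smul_eq_mul]
  · linarith [hφ.1 h, hψ.1 h]
  · linarith [hφ.2 h hh, hψ.2 h hh]

/-- A separating functional with the fewest null sets, in the manner of Halmos and Savage. -/
theorem exists_maximal_separatingFunctional (hC : IsSolidCone C) :
    ∃ φ ∈ μ.separatingFunctionals C, ∀ A, φ (μ.indicatorL1 A) = 0 →
      ∀ ψ ∈ μ.separatingFunctionals C, ψ (μ.indicatorL1 A) = 0 := by
  -- The supremum of `S` is at most `1` (take `B = ∅`) and measures how much of `μ` a multiple of
  -- one functional can cover.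
  let S : Set ℝ := {r | ∃ φ ∈ μ.separatingFunctionals C, ∃ n : ℝ, 0 ≤ n ∧
    ∀ B, r ≤ n * φ (μ.indicatorL1 B) + μ.mass Bᶜ}
  have hS0 : (0 : ℝ) ∈ S :=
    ⟨0, ⟨fun h => integral_abs_nonneg h.2, fun _ _ => le_rfl⟩, 0, le_rfl,
      fun B => by simpa using μ.mass_nonneg Bᶜ⟩
  have hSb : BddAbove S := by
    refine ⟨1, ?_⟩
    rintro r ⟨φ, hφ, n, hn, h⟩
    have h1 := h ∅
    have h2 := separatingFunctional_indicator_le hφ (∅ : Set Ω)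
    rw [mass_empty] at h2
    rw [Set.compl_empty, mass_univ] at h1
    nlinarith
  have hex : ∀ k : ℕ, ∃ r ∈ S, sSup S - 1 / (k + 1) < r := fun k =>
    exists_lt_of_lt_csSup ⟨0, hS0⟩ (sub_lt_self _ (by positivity))
  choose r hrS hr using hex
  choose φ hφ n hn hrB using hrS
  obtain ⟨Φ, hΦ, hsum⟩ := exists_hasSum_separatingFunctional hφ
  have hΦk : ∀ k B, φ k (μ.indicatorL1 B) ≤ 2 * 2 ^ k * Φ (μ.indicatorL1 B) := fun k B => by
    have := le_hasSum (hsum (μ.indicatorL1 B)) k fun j _ =>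
      mul_nonneg (by positivity) (separatingFunctional_indicator_nonneg hC (hφ j) B)
    have h2 : (1 : ℝ) / 2 / 2 ^ k * (2 * 2 ^ k) = 1 := by field_simp
    calc φ k (μ.indicatorL1 B) = (2 * 2 ^ k) * (1 / 2 / 2 ^ k * φ k (μ.indicatorL1 B)) := by
          rw [← mul_assoc, mul_comm (2 * 2 ^ k : ℝ), h2, one_mul]
      _ ≤ _ := mul_le_mul_of_nonneg_left this (by positivity)
  refine ⟨Φ, hΦ, fun A hA ψ hψ => ?_⟩
  refine le_antisymm (not_lt.1 fun hpos => ?_) (separatingFunctional_indicator_nonneg hC hψ A)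
  -- If `Φ(A) = 0 < a = ψ(A)`, mixing `ψ` into `Φ` raises every `r k` by `a` within `S`, which
  -- exceeds the supremum once `1 / (k + 1) < a`.
  set a := ψ (μ.indicatorL1 A)
  have hmem : ∀ k, r k + a ∈ S := fun k => by
    refine ⟨_, midpoint_mem_separatingFunctionals hΦ hψ, 2 * (n k * (2 * 2 ^ k) + 1),
      by have := hn k; positivity, fun B => ?_⟩
    have hΦB := separatingFunctional_indicator_nonneg hC hΦ B
    have hψB := separatingFunctional_indicator_nonneg hC hψ B
    -- Testing on `B ∪ A` costs `Φ` nothing since `Φ(A) = 0`, and saves `μ(A ∩ Bᶜ)`. That saving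
    -- pays for `a ≤ ψ(B) + μ(A ∩ Bᶜ)`.
    have h1 := hrB k (B ∪ A)
    have h2 := mul_le_mul_of_nonneg_left (hΦk k (B ∪ A)) (hn k)
    have h3 : Φ (μ.indicatorL1 (B ∪ A)) ≤ Φ (μ.indicatorL1 B) := by
      have h4 := separatingFunctional_indicator_union Φ (Set.disjoint_sdiff_right : Disjoint B (A \ B))
      rw [Set.union_sdiff_self] at h4
      have := separatingFunctional_indicator_mono hC hΦ (Set.sdiff_subset : A \ B ⊆ A)
      linarith
    have h4 : n k * (2 * 2 ^ k * Φ (μ.indicatorL1 (B ∪ A))) ≤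
        n k * (2 * 2 ^ k * Φ (μ.indicatorL1 B)) := by
      have := hn k
      gcongr
    have h5 : a ≤ ψ (μ.indicatorL1 B) + μ.mass (A ∩ Bᶜ) := by
      have h6 := separatingFunctional_indicator_union ψ (A := B) (B := A ∩ Bᶜ)
        Set.disjoint_sdiff_right
      have h7 := separatingFunctional_indicator_mono hC hψ
        (show A ⊆ B ∪ (A ∩ Bᶜ) from fun x hx => by by_cases hB : x ∈ B <;> simp [hB, hx])
      have h8 := separatingFunctional_indicator_le hψ (A ∩ Bᶜ)
      linarith
    have h6 : μ.mass Bᶜ = μ.mass (B ∪ A)ᶜ + μ.mass (A ∩ Bᶜ) := by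
      rw [← μ.mass_union]
      · congr 1
        ext x
        by_cases hA : x ∈ A <;> simp [hA]
      · rw [Set.disjoint_left]
        intro x hx hx'
        exact hx (Or.inr hx'.1)
    have h7 : 0 ≤ n k * (2 * 2 ^ k) * ψ (μ.indicatorL1 B) := by
      have := hn k
      positivity
    simp only [LinearMap.smul_apply, LinearMap.add_apply, smul_eq_mul]
    nlinarith
  obtain ⟨k, hk⟩ := exists_nat_one_div_lt hpos
  have := le_csSup hSb (hmem k)
  linarith [hr k]

end

end FinAddProb

end

/-! ### Probabilities induced by separating functionals -/

noncomputable section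

namespace FinAddProb

variable {Ω : Type*} {μ : FinAddProb Ω} {C : Set (Ω → ℝ)} {φ : μ.L1Submodule →ₗ[ℝ] ℝ}

/-- The normalized finitely additive probability induced by a separating functional. -/
def ofFunctional (hC : IsSolidCone C) (hφ : φ ∈ μ.separatingFunctionals C)
    (h1 : 0 < φ (μ.indicatorL1 Set.univ)) : FinAddProb Ω where
  mass A := φ (μ.indicatorL1 A) / φ (μ.indicatorL1 Set.univ)
  mass_nonneg A := div_nonneg (separatingFunctional_indicator_nonneg hC hφ A) h1.le
  mass_univ := div_self h1.ne'
  mass_union A B h := by rw [separatingFunctional_indicator_union φ h, add_div]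

theorem ofFunctional_mass_le (hC : IsSolidCone C) (hφ : φ ∈ μ.separatingFunctionals C)
    (h1 : 0 < φ (μ.indicatorL1 Set.univ)) (A : Set Ω) :
    (ofFunctional hC hφ h1).mass A ≤ (φ (μ.indicatorL1 Set.univ))⁻¹ * μ.mass A := by
  rw [inv_mul_eq_div]
  exact div_le_div_of_nonneg_right (separatingFunctional_indicator_le hφ A) h1.le

theorem functional_simple (hC : IsSolidCone C) (hφ : φ ∈ μ.separatingFunctionals C)
    (h1 : 0 < φ (μ.indicatorL1 Set.univ)) {s : Ω → ℝ} (hs : (Set.range s).Finite) :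
    φ ⟨s, L1_simple hs⟩ =
      φ (μ.indicatorL1 Set.univ) * (ofFunctional hC hφ h1).simpleIntegral s := by
  have hS : Set.range s ⊆ hs.toFinset := by simp
  have hdec : (⟨s, L1_simple hs⟩ : μ.L1Submodule) =
      ∑ y ∈ hs.toFinset, y • μ.indicatorL1 (s ⁻¹' {y}) := by
    apply Subtype.ext
    ext ω
    rw [Submodule.coe_sum, Finset.sum_apply, Finset.sum_eq_single (s ω)]
    · simp [indicatorL1]
    · intro y _ hy
      simp [indicatorL1, hy.symm]
    · intro h
      exact absurd (hs.mem_toFinset.2 ⟨ω, rfl⟩) h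
  rw [hdec, map_sum, simpleIntegral_eq_sum _ hS, Finset.mul_sum]
  refine Finset.sum_congr rfl fun y _ => ?_
  rw [map_smul, smul_eq_mul, ofFunctional]
  field_simp

theorem ofFunctional_L1 (hC : IsSolidCone C) (hφ : φ ∈ μ.separatingFunctionals C)
    (h1 : 0 < φ (μ.indicatorL1 Set.univ)) : μ.L1 ⊆ (ofFunctional hC hφ h1).L1 :=
  fun _ ⟨s, hs⟩ => ⟨s, hs.of_mass_le (ofFunctional_mass_le hC hφ h1)⟩

/-- Both sides agree on simple functions. Along a determining sequence for `f`, the left side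
converges by the `L¹(μ)` bound, the right side because the sequence is also determining for the
dominated probability. -/
theorem functional_eq_integral (hC : IsSolidCone C) (hφ : φ ∈ μ.separatingFunctionals C)
    (h1 : 0 < φ (μ.indicatorL1 Set.univ)) (f : μ.L1Submodule) :
    φ f = φ (μ.indicatorL1 Set.univ) * (ofFunctional hC hφ h1).integral f := by
  obtain ⟨s, hs⟩ := f.2
  have hlim := (hs.of_mass_le (ofFunctional_mass_le hC hφ h1)).tendsto.const_mul
    (φ (μ.indicatorL1 Set.univ))
  refine tendsto_nhds_unique ?_ hlim
  simp only [← functional_simple hC hφ h1 (hs.simple _)]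
  rw [tendsto_iff_norm_sub_tendsto_zero]
  refine squeeze_zero (fun _ => norm_nonneg _) (fun n => ?_) hs.tendsto_integral_abs_sub
  rw [norm_sub_rev, ← map_sub]
  exact abs_separatingFunctional_le hφ _

end FinAddProb

/-! ### The common order -/

namespace CommonOrder

open FinAddProb

variable {Ω : Type*} {R : CommonOrder Ω}

/-- Apply `affine` with `b = ε⁻¹ 1_A` and `h = 1_A - b g`: the right side becomes `1_A`, while the
left side `ε⁻¹ 1_A (f - g) + 1_A` is pointwise nonpositive. -/
theorem ge_zero_indicator {f g : Ω → ℝ} (h : R.ge f g) {ε : ℝ} (hε : 0 < ε) :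
    R.ge 0 ({ω | f ω - g ω ≤ -ε}.indicator fun _ => 1) := by
  set A := {ω | f ω - g ω ≤ -ε}
  let b : Ω → ℝ := fun ω => ε⁻¹ * A.indicator (fun _ => 1) ω
  let k : Ω → ℝ := fun ω => A.indicator (fun _ => 1) ω - b ω * g ω
  have hb : ∀ ω, 0 ≤ b ω := fun ω => mul_nonneg (inv_pos.2 hε).le (indicator_const_nonneg A ω)
  have h1 := R.affine f g b k h hb ⟨ε⁻¹, fun ω => by
    have : A.indicator (fun _ => (1 : ℝ)) ω ≤ 1 := Set.indicator_le_self' (by simp) ω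
    exact mul_le_of_le_one_right (inv_pos.2 hε).le this⟩
  have h2 : b * g + k = A.indicator fun _ => 1 := by
    ext ω
    simp only [Pi.add_apply, Pi.mul_apply, k]
    ring
  rw [h2] at h1
  refine R.trans _ _ _ (R.mono _ _ fun ω => ?_) h1
  simp only [Pi.add_apply, Pi.mul_apply, Pi.zero_apply, k, b]
  by_cases hω : ω ∈ A
  · simp only [Set.indicator_of_mem hω]
    have h3 : ε⁻¹ * (f ω - g ω) ≤ ε⁻¹ * -ε :=
      mul_le_mul_of_nonneg_left hω (inv_pos.2 hε).le
    have h4 : ε⁻¹ * -ε = -1 := by field_simp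
    linarith
  · simp [hω]

theorem aenonneg_sub_of_ge {m : FinAddProb Ω}
    (hm : ∀ A : Set Ω, R.ge 0 (A.indicator fun _ => 1) → m.mass A = 0) {f g : Ω → ℝ}
    (h : R.ge f g) : m.AENonneg fun ω => f ω - g ω :=
  fun _ hε => hm _ (ge_zero_indicator h hε)

theorem subset_superhedgeable {𝒳 : Set (Ω → ℝ)} (h𝒳 : R.IsAssetSet 𝒳) :
    𝒳 ⊆ R.superhedgeable 𝒳 := by
  intro X hX
  obtain ⟨a, ha⟩ := h𝒳.bounded_loss X hX
  refine ⟨1, one_pos, _, h𝒳.add_cash X hX (2 * |a|) (by positivity), ?_⟩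
  -- The weight `2` on `{X < 0}` reflects `X` to `-X` there, turning `X ≥_* a` into a bound on
  -- `|X|`; the cash `2|a|` absorbs the resulting term `2a`.
  let b : Ω → ℝ := {ω | X ω < 0}.indicator fun _ => 2
  have h1 := R.affine X (fun _ => a) b (fun ω => X ω + 2 * |a| - b ω * X ω) ha
    (fun ω => Set.indicator_nonneg (fun _ _ => zero_le_two) ω)
    ⟨2, fun ω => Set.indicator_le_self' (by simp) ω⟩
  have h2 : b * X + (fun ω => X ω + 2 * |a| - b ω * X ω) = (1 : ℝ) • fun ω => X ω + 2 * |a| := by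
    ext ω
    simp
  rw [h2] at h1
  refine R.trans _ _ _ h1 (R.mono _ _ fun ω => ?_)
  have h3 := neg_abs_le a
  have h4 := abs_nonneg a
  simp only [Pi.add_apply, Pi.mul_apply, b]
  by_cases h : X ω < 0
  · simp only [Set.mem_ofPred_eq, h, Set.indicator_of_mem, abs_of_neg h]
    linarith
  · rw [Set.indicator_of_notMem (by simpa using h), abs_of_nonneg (not_lt.1 h)]
    linarith

theorem mass_eq_zero_of_mem_strictPricingMeasures {𝒳 : Set (Ω → ℝ)} {π : 𝒳 → ℝ}
    {m : FinAddProb Ω} (hm : m ∈ R.strictPricingMeasures π) (A : Set Ω)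
    (hA : R.ge 0 (A.indicator fun _ => 1)) : m.mass A = 0 := by
  by_contra hne
  have hpos : 0 < m.mass A := lt_of_le_of_ne (m.mass_nonneg A) (Ne.symm hne)
  -- Since `0 ≥_* 1_A`, this `f` satisfies `f ≥_* 1 >_* 0`; yet `f ≤ 1` and its integral is `0`.
  let f : Ω → ℝ := fun ω => 1 - (m.mass A)⁻¹ * A.indicator (fun _ => 1) ω
  have hf1 : f ≤ 1 := fun ω =>
    sub_le_self _ (mul_nonneg (inv_pos.2 hpos).le (indicator_const_nonneg A ω))
  have h1 := R.affine _ _ (fun _ => (m.mass A)⁻¹) f hA (fun _ => (inv_pos.2 hpos).le)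
    ⟨_, fun _ => le_rfl⟩
  have h2 : (fun _ => (m.mass A)⁻¹) * A.indicator (fun _ => 1) + f = 1 := by
    ext ω
    simp [f]
  rw [h2, mul_zero, zero_add] at h1
  have hgt : R.gt f 0 := ⟨R.trans _ _ _ h1 R.one_gt_zero.1,
    fun h => R.one_gt_zero.2 (R.trans _ _ _ h (R.trans _ _ _ h1 (R.refl 1)))⟩
  have h3 := hm.2 f hgt
  rw [inf_eq_left.2 hf1, integral_sub (L1_const 1)
    (L1_const_mul (L1_simple (finite_range_indicator A 1)) _), integral_const,
    integral_const_mul (L1_simple (finite_range_indicator A 1)), integral_indicator,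
    inv_mul_cancel₀ hne, sub_self] at h3
  exact lt_irrefl _ h3

theorem closureL1_netCone_inter_eq_empty {𝒳 : Set (Ω → ℝ)} (h𝒳 : R.IsAssetSet 𝒳) {π : 𝒳 → ℝ}
    {m : FinAddProb Ω} (hm : m ∈ R.strictPricingMeasures π) :
    𝒳 ⊆ m.L1 ∧ m.closureL1 (R.netCone π) ∩ {f | R.gt f 0} = ∅ := by
  have hX : 𝒳 ⊆ m.L1 := (subset_superhedgeable h𝒳).trans hm.1.1
  refine ⟨hX, Set.eq_empty_of_forall_notMem ?_⟩
  rintro f ⟨⟨hf, happrox⟩, hgt⟩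
  have hpos : 0 < m.integral f :=
    (hm.2 f hgt).trans_le (integral_mono (L1_min hf (L1_const 1)) hf fun ω => min_le_left _ _)
  -- A distance below `∫ f` forces `∫ g > 0`, against `∫ g ≤ c (∫ X - π X) ≤ 0`.
  obtain ⟨g, ⟨c, hc, X, hge⟩, hg, hlt⟩ := happrox _ hpos
  have hXm := hX X.2
  have hXc : (fun ω => (X : Ω → ℝ) ω - π X) ∈ m.L1 := L1_sub hXm (L1_const _)
  have h1 := integral_mono_ae hg (L1_const_mul hXc c)
    (aenonneg_sub_of_ge (mass_eq_zero_of_mem_strictPricingMeasures hm) hge)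
  rw [integral_const_mul hXc, integral_sub hXm (L1_const _), integral_const] at h1
  have h2 := integral_mono (L1_sub hf hg) (L1_abs (L1_sub hf hg)) fun ω => le_abs_self _
  rw [integral_sub hf hg] at h2
  nlinarith [hm.1.2 X]

/-! ### From a separating measure to a strictly positive pricing measure -/

theorem mem_netCone_of_ge_zero {𝒳 : Set (Ω → ℝ)} (h𝒳 : R.IsAssetSet 𝒳) {π : 𝒳 → ℝ}
    (hπ : R.IsPriceFunction 𝒳 π) {f : Ω → ℝ} (hf : R.ge 0 f) : f ∈ R.netCone π := by
  have h0 := hπ.pos_homogeneous 0 ⟨0, h𝒳.zero_mem⟩ ⟨0, h𝒳.zero_mem⟩ le_rfl (by simp)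
  refine ⟨1, one_pos, ⟨0, h𝒳.zero_mem⟩, ?_⟩
  have h1 : π ⟨0, h𝒳.zero_mem⟩ = 0 := by rw [h0, zero_mul]
  have h2 : (fun ω => 1 * ((0 : Ω → ℝ) ω - π ⟨0, h𝒳.zero_mem⟩)) = 0 := by
    ext ω
    rw [h1, one_mul, sub_zero]
  exact R.trans _ _ _ (R.mono _ _ h2.ge) hf

theorem isSolidCone_netCone {𝒳 : Set (Ω → ℝ)} (h𝒳 : R.IsAssetSet 𝒳) {π : 𝒳 → ℝ}
    (hπ : R.IsPriceFunction 𝒳 π) : IsSolidCone (R.netCone π) where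
  add_mem := by
    rintro f ⟨c, hc, X, hX⟩ g ⟨d, hd, Y, hY⟩
    have hcd : 0 < c + d := by positivity
    have hc1 : 0 ≤ c / (c + d) := by positivity
    have hd1 : 0 ≤ d / (c + d) := by positivity
    have hsum : c / (c + d) + d / (c + d) = 1 := by field_simp
    let X' : 𝒳 := ⟨(c / (c + d)) • (X : Ω → ℝ),
      h𝒳.convex.smul_mem_of_zero_mem h𝒳.zero_mem X.2 ⟨hc1, by linarith⟩⟩
    let Y' : 𝒳 := ⟨(d / (c + d)) • (Y : Ω → ℝ),
      h𝒳.convex.smul_mem_of_zero_mem h𝒳.zero_mem Y.2 ⟨hd1, by linarith⟩⟩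
    -- `𝒳` is only convex, so the two positions are merged with weights summing to `1` and the total
    -- scale `c + d` is put outside.
    let Z : 𝒳 := ⟨_, h𝒳.convex X.2 Y.2 hc1 hd1 hsum⟩
    have hZ : π Z ≤ c / (c + d) * π X + d / (c + d) * π Y := by
      rw [← hπ.pos_homogeneous _ X X' hc1 rfl, ← hπ.pos_homogeneous _ Y Y' hd1 rfl]
      exact hπ.subadditive X' Y' Z rfl
    refine ⟨c + d, hcd, Z, ?_⟩
    have h1 := R.affine _ _ 1 (fun ω => d * ((Y : Ω → ℝ) ω - π Y)) hX zero_le_one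
      ⟨1, fun _ => le_rfl⟩
    have h2 := R.affine _ _ 1 f hY zero_le_one ⟨1, fun _ => le_rfl⟩
    rw [one_mul, one_mul] at h1 h2
    rw [add_comm _ f, add_comm _ f] at h2
    refine R.trans _ _ _ (R.mono _ _ fun ω => ?_) (R.trans _ _ _ h1 h2)
    simp only [Pi.add_apply, Z, Pi.smul_apply, smul_eq_mul]
    have h3 := mul_le_mul_of_nonneg_left hZ hcd.le
    have h4 : (c + d) * (c / (c + d) * π X + d / (c + d) * π Y) = c * π X + d * π Y := by
      field_simp
    have h5 : (c + d) * (c / (c + d) * (X : Ω → ℝ) ω + d / (c + d) * (Y : Ω → ℝ) ω) =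
        c * (X : Ω → ℝ) ω + d * (Y : Ω → ℝ) ω := by
      field_simp
    linarith
  smul_mem := by
    rintro c hc f ⟨d, hd, X, hX⟩
    refine ⟨c * d, by positivity, X, ?_⟩
    have h1 := R.affine _ _ (fun _ => c) 0 hX (fun _ => hc.le) ⟨c, fun _ => le_rfl⟩
    rw [add_zero, add_zero] at h1
    have h2 : (fun ω => c * d * ((X : Ω → ℝ) ω - π X)) =
        (fun _ => c) * fun ω => d * ((X : Ω → ℝ) ω - π X) := by
      ext ω
      exact mul_assoc _ _ _
    rw [h2]
    exact h1
  mem_of_nonpos f hf := mem_netCone_of_ge_zero h𝒳 hπ (R.mono _ _ hf)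

theorem exists_mem_strictPricingMeasures {𝒳 : Set (Ω → ℝ)} (h𝒳 : R.IsAssetSet 𝒳) {π : 𝒳 → ℝ}
    (hπ : R.IsPriceFunction 𝒳 π) {μ : FinAddProb Ω} (hX : 𝒳 ⊆ μ.L1)
    (hμ : μ.closureL1 (R.netCone π) ∩ {f | R.gt f 0} = ∅) :
    (R.strictPricingMeasures π).Nonempty := by
  have hC := isSolidCone_netCone h𝒳 hπ
  have hsep : ∀ f : μ.L1Submodule, R.gt f 0 → ∃ φ ∈ μ.separatingFunctionals (R.netCone π), 0 < φ f :=
    fun f hf => exists_separatingFunctional_pos hC f fun hcl =>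
      Set.notMem_empty (f : Ω → ℝ) (hμ ▸ ⟨hcl, hf⟩)
  obtain ⟨φ, hφ, hmax⟩ := exists_maximal_separatingFunctional (μ := μ) hC
  -- If `φ` vanished on `Ω`, maximality would make every separating functional vanish on the
  -- constant `1 >_* 0`.
  have h1 : 0 < φ (μ.indicatorL1 Set.univ) := by
    refine lt_of_le_of_ne (separatingFunctional_indicator_nonneg hC hφ _) fun h => ?_
    obtain ⟨ψ, hψ, hpos⟩ := hsep (μ.indicatorL1 Set.univ) (by
      have h1 : (μ.indicatorL1 Set.univ : Ω → ℝ) = 1 := Set.indicator_univ _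
      rw [h1]
      exact R.one_gt_zero)
    exact hpos.ne' (hmax _ h.symm ψ hψ)
  set m := ofFunctional hC hφ h1
  have hL1 : μ.L1 ⊆ m.L1 := ofFunctional_L1 hC hφ h1
  have hint : ∀ f : μ.L1Submodule, φ f = φ (μ.indicatorL1 Set.univ) * m.integral f :=
    functional_eq_integral hC hφ h1
  have hnull : ∀ A : Set Ω, R.ge 0 (A.indicator fun _ => 1) → m.mass A = 0 := fun A hA => by
    have h2 := hφ.2 (μ.indicatorL1 A) (mem_netCone_of_ge_zero h𝒳 hπ hA)
    have h3 : m.mass A = φ (μ.indicatorL1 A) / φ (μ.indicatorL1 Set.univ) := rfl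
    rw [h3, le_antisymm h2 (separatingFunctional_indicator_nonneg hC hφ A), zero_div]
  refine ⟨m, ⟨?_, fun X => ?_⟩, fun f hf => ?_⟩
  · rintro g ⟨c, hc, X, hXm, hge⟩
    exact L1_of_abs_le_ae (L1_const_mul (hL1 (hX hXm)) c) (aenonneg_sub_of_ge hnull hge)
  · have hXμ := hX X.2
    have h2 := hφ.2 ⟨_, L1_sub hXμ (L1_const (π X))⟩
      ⟨1, one_pos, X, by simpa using R.refl _⟩
    rw [hint] at h2
    have h3 := nonpos_of_mul_nonpos_right h2 h1
    rw [integral_sub (hL1 hXμ) (L1_const _), integral_const] at h3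
    linarith
  · obtain ⟨hg0, hg1⟩ := R.trunc f hf
    set g : Ω → ℝ := f ⊓ 1
    have hgle : ∀ ω, g ω ≤ 1 := fun ω => min_le_right _ _
    have hp : ∀ ω, |max (g ω) 0| ≤ 1 := fun ω => by
      rw [abs_of_nonneg (le_max_right _ _)]
      exact max_le (hgle ω) zero_le_one
    -- `f ∧ 1` may be unbounded below and outside `L¹(μ)`. Its positive part is bounded, still `>_*
    -- 0`, and differs from it by an `m`-null function.
    let p : μ.L1Submodule := ⟨fun ω => max (g ω) 0, L1_of_bounded hp⟩
    have hpm : (p : Ω → ℝ) ∈ m.L1 := hL1 p.2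
    have hp0 : ∀ ω, 0 ≤ (p : Ω → ℝ) ω := fun ω => le_max_right _ _
    have hpgt : R.gt p 0 :=
      ⟨R.mono _ _ hp0, fun h => hg1 (R.trans _ _ _ h (R.mono _ _ fun ω => le_max_left _ _))⟩
    have hae : m.AENonneg fun ω => g ω - (p : Ω → ℝ) ω := fun ε hε => by
      refine m.mass_eq_zero_of_subset (fun ω hω => ?_) (aenonneg_sub_of_ge hnull hg0 ε hε)
      simp only [Set.mem_ofPred_eq, p, Pi.zero_apply, sub_zero] at hω ⊢
      rcases le_total (g ω) 0 with h | h
      · rwa [max_eq_right h, sub_zero] at hω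
      · rw [max_eq_left h] at hω
        linarith
    have hgm : g ∈ m.L1 := L1_of_abs_le_ae (L1_const 1) fun ε hε => by
      refine m.mass_eq_zero_of_subset (fun ω hω => ?_) (aenonneg_sub_of_ge hnull hg0 ε hε)
      simp only [Set.mem_ofPred_eq, Pi.zero_apply, sub_zero] at hω ⊢
      rcases le_total (g ω) 0 with h | h
      · rw [abs_of_nonpos h] at hω
        linarith
      · rw [abs_of_nonneg h] at hω
        linarith [hgle ω]
    refine lt_of_lt_of_le ?_ (integral_mono_ae hpm hgm hae)
    refine lt_of_le_of_ne (integral_nonneg hpm (AENonneg.of_nonneg hp0)) fun h0 => ?_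
    obtain ⟨ψ, hψ, hpos⟩ := hsep p hpgt
    obtain ⟨ε, hε, hεlt⟩ : ∃ ε : ℝ, 0 < ε ∧ ε * ψ (μ.indicatorL1 Set.univ) < ψ p := by
      have hu := separatingFunctional_indicator_nonneg hC hψ (Set.univ : Set Ω)
      refine ⟨ψ p / (ψ (μ.indicatorL1 Set.univ) + 1), by positivity, ?_⟩
      rw [div_mul_eq_mul_div, div_lt_iff₀ (by positivity)]
      nlinarith
    have hA : ψ (μ.indicatorL1 {ω | ε ≤ (p : Ω → ℝ) ω}) = 0 := by
      refine hmax _ ?_ ψ hψ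
      have h2 := mass_mul_le_integral hpm hp0 hε
      rw [← h0, zero_div] at h2
      have h3 := le_antisymm h2 (m.mass_nonneg _)
      exact (div_eq_zero_iff.1 h3).resolve_right h1.ne'
    -- Since `p ≤ 1_{p ≥ ε} + ε` and `ψ` ignores the level set, `ψ(p) ≤ ε ψ(1)`, against the choice
    -- of `ε`.
    have hle := separatingFunctional_mono hC hψ p
      (μ.indicatorL1 {ω | ε ≤ (p : Ω → ℝ) ω} + ε • μ.indicatorL1 Set.univ) fun ω => by
        have hpω : (p : Ω → ℝ) ω ≤ 1 := max_le (hgle ω) zero_le_one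
        change _ ≤ Set.indicator {ω | ε ≤ (p : Ω → ℝ) ω} (fun _ => (1 : ℝ)) ω +
          ε * Set.indicator Set.univ (fun _ => (1 : ℝ)) ω
        rw [Set.indicator_univ]
        by_cases h : ε ≤ (p : Ω → ℝ) ω
        · rw [Set.indicator_of_mem (by exact h)]
          linarith
        · rw [Set.indicator_of_notMem (by exact h)]
          linarith
    rw [map_add, map_smul, smul_eq_mul, hA, zero_add] at hle
    linarith

end CommonOrder

end

theorem mainTheorem5 {Ω : Type*} [Nonempty Ω] (R : CommonOrder Ω)
    (𝒳 : Set (Ω → ℝ)) (h𝒳 : R.IsAssetSet 𝒳)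
    (π : 𝒳 → ℝ) (hπ : R.IsPriceFunction 𝒳 π) :
    ((R.strictPricingMeasures π).Nonempty ↔
      ∃ μ : FinAddProb Ω,
        𝒳 ⊆ μ.L1 ∧ μ.closureL1 (R.netCone π) ∩ {f | R.gt f 0} = ∅) ∧
    ((R.strictPricingMeasures π).Nonempty →
      ∃ μ ∈ R.strictPricingMeasures π,
        𝒳 ⊆ μ.L1 ∧ μ.closureL1 (R.netCone π) ∩ {f | R.gt f 0} = ∅) := by
  have key : (R.strictPricingMeasures π).Nonempty →
      ∃ μ ∈ R.strictPricingMeasures π,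
        𝒳 ⊆ μ.L1 ∧ μ.closureL1 (R.netCone π) ∩ {f | R.gt f 0} = ∅ :=
    fun ⟨m, hm⟩ => ⟨m, hm, CommonOrder.closureL1_netCone_inter_eq_empty h𝒳 hm⟩
  refine ⟨⟨fun h => ?_, fun ⟨μ, hX, hμ⟩ =>
    CommonOrder.exists_mem_strictPricingMeasures h𝒳 hπ hX hμ⟩, key⟩
  obtain ⟨μ, _, hμ⟩ := key h
  exact ⟨μ, hμ⟩
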